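/- **Theorem (linking graphs determine quivers and cocycle invariants).** For $n\ge 0$ and a permutation $\sigma$ of $\{1,\dots,n\}$, let $P_n^\sigma=\{0,1,\dots,n\}$ be the quandle with $x*y=x$ if $y\ne 0$, $x*0=\sigma(x)$ if $x\neq 0$, and $0*0=0$. Links are oriented classical links, given by diagrams on the sphere. *Colorings.* For a quandle $X$, an $X$-coloring of a link diagram assigns elements of $X$ to its arcs so that, at each crossing with over arc colored $y$, the under arc on the right of the oriented over arc has some color $x$ and the under arc on its left has color $x*y$. *Quiver.* For $S\subseteq \mathrm{End}(X)$, the quandle quiver $\mathcal Q_X^S(L)$ has the $X$-colorings of a diagram of $L$ as vertices and, for each coloring $c$ and each $f\in S$, an edge from $c$ to $f\circ c$. An isomorphism of quivers is a bijection of vertices together with a compatible bijection of edges. *Cocycle invariant.* For a quandle 2-cocycle $\theta:X\times X\to A$ with values in a multiplicative abelian group and finite $X$, let $$\Phi_\theta(L)=\sum_{X\text{-colorings}}\ \prod_{c}\theta(x_c,y_c)^{\epsilon_c}\in\mathbb Z[A],$$ where $c$ runs over the crossings, $\epsilon_c=\pm1$ is the sign of $c$, $y_c$ is the color of the over arc,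 and $x_c$ is the color of the under arc on the right of the over arc. When $\sigma$ is an $n$-cycle, $\theta$ denotes the 2-cocycle of $P_n^\sigma$ with values in the infinite cyclic group $\langle t\rangle$ given by $\theta(0,a)=t$ for $a\neq 0$ and $\theta=1$ on all other pairs. *Linking graph.* The linking graph of a link is the complete graph on its components in which the edge between $K\neq K'$ has as weight the linking number $\mathrm{lk}(K,K')$, that is, half the sum of the signs of the crossings between $K$ and $K'$ in a diagram. An isomorphism of linking graphs is a bijection of the components that preserves all weights. Let $L$ and $L'$ be links with isomorphic linking graphs, with all of the above computed from a diagram $D$ of $L$ and a diagram $D'$ of $L'$. Then: 1. for every $n$, every permutation $\sigma$ of $\{1,\dots,n\}$ and every $S\subseteq\mathrm{End}(P_n^\sigma)$, the quivers $\mathcal Q^S_{P_n^\sigma}(L)$ and $\mathcal Q^S_{P_n^\sigma}(L')$ are isomorphic; 2. for every $n$ and every $n$-cycle $\sigma$, $\Phi_\theta(L)=\Phi_\theta(L')$. -/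

import Mathlib

open scoped Quandles

/-! ### Diagrams of oriented links

A diagram of an oriented classical link is given by its signed oriented Gauss code, i.e. by the
underlying 4-valent graph of the projection together with crossing signs and over/under
information, and the requirement that this graph is drawn on the sphere.  -/

/-- An oriented signed Gauss code.  A *pass* is a pair `(c, b)`, where `c` is a crossing;
`(c, true)` is the passage of the link through `c` as the over strand and `(c, false)` the passage
as the under strand. `next p` is the pass that follows `p` when one travels along the oriented
link. `loops` is the number of components that have no crossing at all. -/
structure GaussCode where
  Crossing : Type
  [fintypeCrossing : Fintype Crossing]
  [decEqCrossing : DecidableEq Crossing]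
  sign : Crossing → ℤˣ
  next : Equiv.Perm (Crossing × Bool)
  loops : ℕ

attribute [instance] GaussCode.fintypeCrossing GaussCode.decEqCrossing

namespace GaussCode

variable (G : GaussCode)

/-- Passes through crossings. A pass `p` also names the oriented edge of the diagram
that runs from `p` to `next p`. -/
abbrev Pass : Type := G.Crossing × Bool

/-- Half-edges at the crossings: `(p, true)` is the half-edge that leaves `p`, and `(p, false)` the
half-edge that arrives at `p`. -/
abbrev HalfEdge : Type := G.Pass × Bool

/-- The counterclockwise successor of a half-edge around its crossing. The counterclockwise order
is over-out, under-out, over-in, under-in at a positive crossing, and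
over-out, under-in, over-in, under-out at a negative crossing. -/
def rot : Equiv.Perm G.HalfEdge where
  toFun h := match h with
    | ((c, true), d) => ((c, false), if G.sign c = 1 then d else !d)
    | ((c, false), d) => ((c, true), if G.sign c = 1 then !d else d)
  invFun h := match h with
    | ((c, false), d) => ((c, true), if G.sign c = 1 then d else !d)
    | ((c, true), d) => ((c, false), if G.sign c = 1 then !d else d)
  left_inv := by
    rintro ⟨⟨c, b⟩, d⟩
    cases b <;> by_cases h : G.sign c = 1 <;> simp [h]
  right_inv := by
    rintro ⟨⟨c, b⟩, d⟩
    cases b <;> by_cases h : G.sign c = 1 <;> simp [h]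

/-- The involution that exchanges the two ends of each edge. -/
def flip : Equiv.Perm G.HalfEdge where
  toFun h := match h with
    | (p, true) => (G.next p, false)
    | (p, false) => (G.next.symm p, true)
  invFun h := match h with
    | (p, true) => (G.next p, false)
    | (p, false) => (G.next.symm p, true)
  left_inv := by rintro ⟨p, d⟩; cases d <;> simp
  right_inv := by rintro ⟨p, d⟩; cases d <;> simp

/-- The faces of the surface that carries the code: the cycles of half-edges obtained by
alternately running along an edge and turning to the next half-edge at the crossing reached. -/
def Face : Type := Quotient (Equiv.Perm.SameCycle.setoid (G.rot * G.flip))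

/-- The 4-valent graph of the projection, as a simple graph on the crossings
(only its connected components matter). -/
def shadow : SimpleGraph G.Crossing :=
  SimpleGraph.fromRel fun c c' => ∃ b, (G.next (c, b)).1 = c'

/-- The code is drawn on spheres, one for each connected component of the shadow: `V - E + F = 2k`,
where `V` is the number of crossings, `E = 2V` the number of edges, `F` the number of faces and `k`
the number of connected components of the shadow. -/
def Planar : Prop :=
  Nat.card G.Face = Nat.card G.Crossing + 2 * Nat.card G.shadow.ConnectedComponent

end GaussCode

/-- A diagram of an oriented classical link: a planar Gauss code. -/
structure LinkDiagram extends GaussCode where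
  planar : toGaussCode.Planar

namespace LinkDiagram

/-- The components of the link: the cycles of passes, and the components without crossings. -/
def Component (D : LinkDiagram) : Type :=
  Quotient (Equiv.Perm.SameCycle.setoid D.next) ⊕ Fin D.loops

/-- The component to which a pass belongs. -/
def componentOf (D : LinkDiagram) (p : D.Pass) : D.Component :=
  Sum.inl (Quotient.mk (Equiv.Perm.SameCycle.setoid D.next) p)

open Classical in
/-- The pairwise linking number of two components: half the sum of the signs of the crossings
between them. -/
noncomputable def linkingNumber (D : LinkDiagram) (i j : D.Component) : ℚ :=
  (∑ c : D.Crossing,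
    if (D.componentOf (c, true) = i ∧ D.componentOf (c, false) = j) ∨
        (D.componentOf (c, true) = j ∧ D.componentOf (c, false) = i)
      then ((D.sign c : ℤ) : ℚ) else 0) / 2

/-- The linking graphs of two diagrams are isomorphic. The linking graph is the complete graph on
the components in which the edge between `i ≠ j` has weight `linkingNumber i j`. -/
def LinkingGraphsIsomorphic (D D' : LinkDiagram) : Prop :=
  ∃ e : D.Component ≃ D'.Component,
    ∀ i j, i ≠ j → D'.linkingNumber (e i) (e j) = D.linkingNumber i j

end LinkDiagram

/-! ### Colorings

Quandle operations are written on the other side in Mathlib: `y ◃ x` is `x * y`. -/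

/-- A coloring of a diagram by a quandle. `edge p` is the color of the edge from `p` to `next p`, so
`edge (next.symm p)` is the color of the edge that arrives at `p`. Colors do not change at over
passes, so they are colors of arcs. At an under pass with over color `y`, the under arcs on the
right and on the left of the over strand have colors `x` and `x * y`; the under strand runs from
right to left at a positive crossing, and from left to right at a negative one. -/
@[ext]
structure Coloring (X : Type*) [Quandle X] (D : LinkDiagram) where
  edge : D.Pass → X
  loop : Fin D.loops → X
  over_pass : ∀ c, edge (D.next.symm (c, true)) = edge (c, true)
  under_pos : ∀ c, D.sign c = 1 →
    edge (c, false) = edge (c, true) ◃ edge (D.next.symm (c, false))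
  under_neg : ∀ c, D.sign c = -1 →
    edge (D.next.symm (c, false)) = edge (c, true) ◃ edge (c, false)

namespace Coloring

variable {X : Type*} [Quandle X] {D : LinkDiagram}

instance [Finite X] : Finite (Coloring X D) :=
  Finite.of_injective (fun C : Coloring X D => (C.edge, C.loop)) fun _ _ h =>
    Coloring.ext (congrArg Prod.fst h) (congrArg Prod.snd h)

/-- An endomorphism acts on colorings by replacing each color by its image. -/
def map (f : X →◃ X) (C : Coloring X D) : Coloring X D where
  edge p := f.toFun (C.edge p)
  loop i := f.toFun (C.loop i)
  over_pass c := congrArg f.toFun (C.over_pass c)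
  under_pos c h := (congrArg f.toFun (C.under_pos c h)).trans f.map_act'
  under_neg c h := (congrArg f.toFun (C.under_neg c h)).trans f.map_act'

/-- The color `x` of the under arc on the right of the over strand, from which the other under
arc gets its color `x * y`. -/
def underColor (C : Coloring X D) (c : D.Crossing) : X :=
  if D.sign c = 1 then C.edge (D.next.symm (c, false)) else C.edge (c, false)

/-- The color of the over arc. -/
def overColor (C : Coloring X D) (c : D.Crossing) : X := C.edge (c, true)

end Coloring

/-! ### Quandle quivers -/

/-- The vertices of the quandle quiver of `D` with respect to a set `S` of endomorphisms of `X`: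
the colorings of `D`. -/
def QuandleQuiver {X : Type*} [Quandle X] (_S : Set (X →◃ X)) (D : LinkDiagram) : Type _ :=
  Coloring X D

/-- The quandle quiver has one edge from `C` to `f ∘ C` for each coloring `C` and each `f ∈ S`. -/
instance {X : Type*} [Quandle X] (S : Set (X →◃ X)) (D : LinkDiagram) :
    Quiver (QuandleQuiver S D) where
  Hom C C' := {f : X →◃ X // f ∈ S ∧ Coloring.map f C = C'}

/-- An isomorphism of quivers: a bijection between the vertices together with a
compatible bijection between the edges. -/
structure QuiverIso (V W : Type*) [Quiver V] [Quiver W] where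
  vertexEquiv : V ≃ W
  edgeEquiv : ∀ a b : V, (a ⟶ b) ≃ (vertexEquiv a ⟶ vertexEquiv b)

/-! ### Cocycle invariants -/

/-- A quandle 2-cocycle of `X` with values in a multiplicative abelian group. -/
structure TwoCocycle (X A : Type*) [Quandle X] [CommGroup A] where
  toFun : X → X → A
  cocycle : ∀ x₀ x₁ x₂ : X, toFun x₀ x₁ * toFun (x₁ ◃ x₀) x₂ *
    (toFun x₀ x₂)⁻¹ * (toFun (x₂ ◃ x₀) (x₂ ◃ x₁))⁻¹ = 1
  diag : ∀ x : X, toFun x x = 1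

/-- The weight of a colored diagram: the product over all crossings of `θ(x, y)^ε`, where `x` is the
color of the under arc on the right of the over strand, `y` the color of the over arc, and `ε` the
sign of the crossing. -/
def Coloring.weight {X A : Type*} [Quandle X] [CommGroup A] {D : LinkDiagram}
    (θ : TwoCocycle X A) (C : Coloring X D) : A :=
  ∏ c : D.Crossing, θ.toFun (C.underColor c) (C.overColor c) ^ (D.sign c : ℤ)

open Classical in
/-- The quandle cocycle invariant, in the group ring `ℤ[A]`: the formal sum of the weights of all
colorings. -/
noncomputable def cocycleInvariant {X A : Type*} [Quandle X] [Finite X] [CommGroup A]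
    (θ : TwoCocycle X A) (D : LinkDiagram) : MonoidAlgebra ℤ A :=
  letI := Fintype.ofFinite (Coloring X D)
  ∑ C : Coloring X D, MonoidAlgebra.single (C.weight θ) 1

/-! ### The quandles with one non-trivial column -/

/-- The underlying set `{0, 1, …, n}` of the quandle `P_n^σ`. Here `none` is `0`, and `some` embeds
the set of `n` positive elements, which `σ` permutes. -/
def PQuandle {n : ℕ} (_σ : Equiv.Perm (Fin n)) : Type := Option (Fin n)

namespace PQuandle

variable {n : ℕ} (σ : Equiv.Perm (Fin n))

instance : Finite (PQuandle σ) := inferInstanceAs (Finite (Option (Fin n)))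

/-- `act σ y x` is `x * y`: it is `x` if `y ≠ 0`, it is `σ x` if `y = 0` and `x ≠ 0`, and it
is `0` if `x = y = 0`. -/
def act : PQuandle σ → PQuandle σ → PQuandle σ
  | some _, x => x
  | none, some k => some (σ k)
  | none, none => none

instance : Quandle (PQuandle σ) where
  act := act σ
  self_distrib := by rintro (_ | x) (_ | y) (_ | z) <;> rfl
  invAct := act σ.symm
  left_inv := by
    rintro (_ | x) (_ | y)
    · rfl
    · exact congrArg some (σ.symm_apply_apply y)
    · rfl
    · rfl
  right_inv := by
    rintro (_ | x) (_ | y)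
    · rfl
    · exact congrArg some (σ.apply_symm_apply y)
    · rfl
    · rfl
  fix := by rintro (_ | x) <;> rfl

/-- The 2-cocycle `θ` with values in the infinite cyclic group generated by `t = ofAdd 1`: it is
`t` on the pairs `(0, a)` with `a` positive, and `1` on all other pairs. -/
def theta : TwoCocycle (PQuandle σ) (Multiplicative ℤ) where
  toFun
    | none, some _ => Multiplicative.ofAdd 1
    | none, none => 1
    | some _, _ => 1
  cocycle := by rintro (_ | x) (_ | y) (_ | z) <;> rfl
  diag := by rintro (_ | x) <;> rfl

end PQuandle

/-! ### Planar codes have no first homology -/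

namespace GaussCode

variable (G : GaussCode)

/-! In a coloring by `PQuandle σ`, a strand that passes under color 0 has its color moved by `shift
σ` or its inverse, and otherwise keeps it. Both permutations fix 0, so each component is entirely 0
or entirely nonzero. A coloring therefore amounts to one color per component, at a base point, such
that a full turn around each component returns to the starting color (`isAdmissible_baseColor`,
`baseColor_injective`, `exists_baseColor_eq`). For a component of color 0 this closing condition is
vacuous. For a nonzero one, the exponent of the full turn is the signed count of its passages under
the zero components, all different from it. The weight for `theta` likewise counts crossings of zero
components under nonzero ones. Self-crossings never enter. It remains to see that the signed count
of crossings where `i` passes over `j` is the linking number. This needs symmetry in `i` and `j`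
(`overSum_comm`), the one place where planarity enters: on a sphere every cycle bounds, so two
cycles have intersection number zero. Endomorphisms act on base colors componentwise, so relabeling
the components commutes with all of them, which gives the quivers for every `S`. -/

instance : Finite G.Face := Quotient.finite _

/-- The face to the right of a half-edge, seen from its crossing. -/
def faceRight (h : G.HalfEdge) : G.Face := Quotient.mk _ h

/-- Both name the sector between `h` and `rot h`: the face permutation `rot * flip` sends `flip h`
to `rot h`. -/
theorem faceRight_rot (h : G.HalfEdge) : G.faceRight (G.rot h) = G.faceRight (G.flip h) := by
  refine Quotient.sound (Equiv.Perm.SameCycle.symm ⟨1, ?_⟩)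
  have hf : G.flip (G.flip h) = h := G.flip.left_inv h
  simp [hf]

/-- A function on the crossings that is constant along edges is constant on the connected
components of the shadow. -/
theorem eq_of_reachable {α : Type*} {b : G.Crossing → α}
    (hb : ∀ p, b (G.next p).1 = b p.1) {c c' : G.Crossing} (h : G.shadow.Reachable c c') :
    b c = b c' := by
  obtain ⟨w⟩ := h
  induction w with
  | nil => rfl
  | cons h _ ih =>
    rw [← ih]
    rcases ((SimpleGraph.fromRel_adj _ _ _).1 h).2 with ⟨x, rfl⟩ | ⟨x, rfl⟩
    · exact (hb (_, x)).symm
    · exact hb (_, x)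

/-- A space of functions that are determined by their values at one crossing in each connected
component of the shadow has at most the dimension given by the number of these components. -/
theorem finrank_le_card_connectedComponent {W : Type*} [AddCommGroup W] [Module ℚ W]
    (φ : W →ₗ[ℚ] (G.Crossing → ℚ)) (hφ : Function.Injective φ)
    (h : ∀ w p, φ w (G.next p).1 = φ w p.1) :
    Module.finrank ℚ W ≤ Nat.card G.shadow.ConnectedComponent := by
  classical
  have : Fintype G.shadow.ConnectedComponent := Fintype.ofFinite _
  let ψ : W →ₗ[ℚ] (G.shadow.ConnectedComponent → ℚ) :=
    (LinearMap.funLeft ℚ ℚ fun K => K.out).comp φ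
  have hψ : Function.Injective ψ := by
    refine (injective_iff_map_eq_zero _).2 fun w hw => (injective_iff_map_eq_zero _).1 hφ w ?_
    funext c
    have h1 : φ w (G.shadow.connectedComponentMk c).out = 0 :=
      congrFun hw (G.shadow.connectedComponentMk c)
    refine (G.eq_of_reachable (h w) (SimpleGraph.ConnectedComponent.exact ?_)).trans h1
    exact (Quot.out_eq (G.shadow.connectedComponentMk c)).symm
  simpa [Nat.card_eq_fintype_card] using LinearMap.finrank_le_finrank_of_injective hψ

/-- The boundary of a linear combination of faces. -/
def faceBoundary : (G.Face → ℚ) →ₗ[ℚ] (G.Pass → ℚ) :=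
  LinearMap.funLeft ℚ ℚ (fun p => G.faceRight (p, true)) -
    LinearMap.funLeft ℚ ℚ (fun p => G.faceRight (G.next p, false))

/-- From `(next p, false)` the edge is seen against its orientation, so the boundary is the value on
the right minus the value on the left. -/
theorem faceBoundary_apply (f : G.Face → ℚ) (p : G.Pass) :
    G.faceBoundary f p = f (G.faceRight (p, true)) - f (G.faceRight (G.next p, false)) := rfl

/-- The incidence matrix of edges and crossings. -/
def incidence : Matrix G.Pass G.Crossing ℚ :=
  fun p c => (if (G.next p).1 = c then 1 else 0) - if p.1 = c then 1 else 0

theorem incidence_mulVec (b : G.Crossing → ℚ) (p : G.Pass) :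
    G.incidence.mulVec b p = b (G.next p).1 - b p.1 := by
  simp [incidence, Matrix.mulVec, dotProduct, sub_mul, Finset.sum_sub_distrib]

theorem incidence_transpose_mulVec (a : G.Pass → ℚ) (c : G.Crossing) :
    G.incidence.transpose.mulVec a c =
      ∑ b, (a (G.next.symm (c, b)) - a (c, b)) := by
  have h : ∑ p, (if (G.next p).1 = c then a p else 0) =
      ∑ p : G.Pass, if p.1 = c then a (G.next.symm p) else 0 := by
    rw [← Equiv.sum_comp G.next fun p => if p.1 = c then a (G.next.symm p) else 0]; simp
  simp only [incidence, Matrix.mulVec, dotProduct, Matrix.transpose_apply, sub_mul,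
    Finset.sum_sub_distrib, ite_mul, one_mul, zero_mul, h]
  simp [Fintype.sum_prod_type, Finset.sum_add_distrib]

/-- The boundary of a boundary vanishes: around a crossing each of the four sectors occurs twice,
with opposite signs. -/
theorem range_faceBoundary_le :
    LinearMap.range G.faceBoundary ≤ LinearMap.ker G.incidence.transpose.mulVecLin := by
  rintro _ ⟨f, rfl⟩
  rw [LinearMap.mem_ker]
  funext c
  rw [Matrix.mulVecLin_apply, incidence_transpose_mulVec]
  have h := G.faceRight_rot
  have h1 := h ((c, true), true)
  have h2 := h ((c, true), false)
  have h3 := h ((c, false), true)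
  have h4 := h ((c, false), false)
  simp only [rot, flip, Equiv.coe_fn_mk] at h1 h2 h3 h4
  simp only [faceBoundary_apply, Fintype.sum_bool, Equiv.apply_symm_apply, Pi.zero_apply]
  rw [← h1, ← h2, ← h3, ← h4]
  by_cases hc : G.sign c = 1 <;> simp [hc] <;> ring

/-- A function on the faces with zero boundary, as a function on crossings. -/
def kerFaceBoundaryToCrossing :
    LinearMap.ker G.faceBoundary →ₗ[ℚ] (G.Crossing → ℚ) :=
  (LinearMap.funLeft ℚ ℚ fun c => G.faceRight ((c, true), true)).comp (Submodule.subtype _)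

theorem eq_kerFaceBoundaryToCrossing (f : LinearMap.ker G.faceBoundary) (h : G.HalfEdge) :
    f.1 (G.faceRight h) = G.kerFaceBoundaryToCrossing f h.1.1 := by
  have hf : ∀ h, f.1 (G.faceRight (G.flip h)) = f.1 (G.faceRight h) := by
    have hp (p : G.Pass) : f.1 (G.faceRight (p, true)) = f.1 (G.faceRight (G.next p, false)) :=
      sub_eq_zero.1 (congrFun (LinearMap.mem_ker.1 f.2) p)
    rintro ⟨p, _ | _⟩
    · simpa [flip] using hp (G.next.symm p)
    · exact (hp p).symm
  have hr (h) : f.1 (G.faceRight (G.rot h)) = f.1 (G.faceRight h) := by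
    rw [faceRight_rot, hf]
  change _ = f.1 (G.faceRight _)
  obtain ⟨⟨c, b⟩, d⟩ := h
  have h1 := hr ((c, true), true)
  have h2 := hr ((c, true), false)
  have h3 := hr ((c, false), true)
  have h4 := hr ((c, false), false)
  simp only [rot, Equiv.coe_fn_mk] at h1 h2 h3 h4
  by_cases hc : G.sign c = 1 <;> simp only [hc, if_true, if_false, Bool.not_true,
    Bool.not_false] at h1 h2 h3 h4 <;> cases b <;> cases d <;> grind

/-- Zero boundary forces equal values on the two sides of every edge, hence on all faces around a
crossing and along each component of the shadow. -/
theorem finrank_ker_faceBoundary_le :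
    Module.finrank ℚ (LinearMap.ker G.faceBoundary) ≤ Nat.card G.shadow.ConnectedComponent := by
  refine G.finrank_le_card_connectedComponent G.kerFaceBoundaryToCrossing ?_ ?_
  · intro f f' h
    refine Subtype.ext (funext fun x => ?_)
    induction x using Quotient.inductionOn with | h x => ?_
    change f.1 (G.faceRight x) = f'.1 (G.faceRight x)
    rw [eq_kerFaceBoundaryToCrossing, h, eq_kerFaceBoundaryToCrossing]
  · intro f p
    rw [← G.eq_kerFaceBoundaryToCrossing f (G.next p, false),
      ← G.eq_kerFaceBoundaryToCrossing f (p, true)]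
    exact (sub_eq_zero.1 (congrFun (LinearMap.mem_ker.1 f.2) p)).symm

theorem finrank_ker_incidence_le :
    Module.finrank ℚ (LinearMap.ker G.incidence.mulVecLin) ≤
      Nat.card G.shadow.ConnectedComponent := by
  refine G.finrank_le_card_connectedComponent (Submodule.subtype _)
    (Submodule.injective_subtype _) fun b p => ?_
  have := congrFun (LinearMap.mem_ker.1 b.2) p
  rw [Matrix.mulVecLin_apply, incidence_mulVec] at this
  exact sub_eq_zero.1 this

variable {G}

/-- On a planar code, every cycle is a boundary. -/
theorem Planar.range_faceBoundary (hG : G.Planar) :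
    LinearMap.range G.faceBoundary = LinearMap.ker G.incidence.transpose.mulVecLin := by
  classical
  refine Submodule.eq_of_le_of_finrank_le G.range_faceBoundary_le ?_
  have : Fintype G.Face := Fintype.ofFinite _
  have h1 := G.finrank_ker_faceBoundary_le
  have h2 := G.finrank_ker_incidence_le
  have h3 := G.faceBoundary.finrank_range_add_finrank_ker
  have h4 := G.incidence.mulVecLin.finrank_range_add_finrank_ker
  have h5 := G.incidence.transpose.mulVecLin.finrank_range_add_finrank_ker
  have h6 : Module.finrank ℚ (LinearMap.range G.incidence.transpose.mulVecLin) =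
    Module.finrank ℚ (LinearMap.range G.incidence.mulVecLin) := G.incidence.rank_transpose
  have h7 := hG
  rw [Planar] at h7
  simp only [Module.finrank_fintype_fun_eq_card, Fintype.card_prod, Fintype.card_bool,
    Nat.card_eq_fintype_card] at h1 h2 h3 h4 h5 h7 ⊢
  -- With `V` crossings, `2V` edges and `V + 2k` faces, the boundaries have dimension at least `(V +
  -- 2k) - k = V + k`, and the cycles at most `2V - (V - k) = V + k`.
  omega

/-- Walking past a crossing, the value of `f` on the right changes according to the boundary of `f`
on the strand that is crossed. -/
theorem faceRight_next_sub (f : G.Face → ℚ) (c : G.Crossing) :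
    f (G.faceRight ((c, true), true)) - f (G.faceRight (G.next.symm (c, true), true)) =
      (G.sign c : ℤ) * (if G.sign c = 1 then G.faceBoundary f (G.next.symm (c, false))
        else G.faceBoundary f (c, false)) ∧
    f (G.faceRight ((c, false), true)) - f (G.faceRight (G.next.symm (c, false), true)) =
      -((G.sign c : ℤ) * (if G.sign c = 1 then G.faceBoundary f (c, true)
        else G.faceBoundary f (G.next.symm (c, true)))) := by
  have h := G.faceRight_rot
  have h1 := h ((c, true), true)
  have h2 := h ((c, true), false)
  have h3 := h ((c, false), true)
  have h4 := h ((c, false), false)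
  simp only [rot, flip, Equiv.coe_fn_mk] at h1 h2 h3 h4
  simp only [faceBoundary_apply, Equiv.apply_symm_apply]
  rw [← h1, ← h2, ← h3, ← h4]
  rcases Int.units_eq_one_or (G.sign c) with hc | hc <;> simp [hc]

/-- Two cycles on a planar code have zero algebraic intersection number. -/
theorem Planar.sum_intersections_eq_zero (hG : G.Planar) {a b : G.Pass → ℚ}
    (ha : ∀ p, a (G.next p) = a p) (hb : ∀ p, b (G.next p) = b p) :
    ∑ c, ((G.sign c : ℤ) : ℚ) * (a (c, true) * b (c, false)) =
      ∑ c, ((G.sign c : ℤ) : ℚ) * (b (c, true) * a (c, false)) := by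
  have ha' (p) : a (G.next.symm p) = a p := by rw [← ha, Equiv.apply_symm_apply]
  have hb' (p) : b (G.next.symm p) = b p := by rw [← hb, Equiv.apply_symm_apply]
  have hmem : a ∈ LinearMap.range G.faceBoundary := by
    rw [hG.range_faceBoundary, LinearMap.mem_ker]
    funext c
    rw [Matrix.mulVecLin_apply, incidence_transpose_mulVec]
    simp [ha']
  obtain ⟨f, hf⟩ := hmem
  -- Write `a` as the boundary of `f` and walk along `b`: the changes of `f` cancel over closed
  -- walks, while each change is a signed value of `a` on the strand crossed.
  have h0 : ∑ p, b p * (f (G.faceRight (p, true)) - f (G.faceRight (G.next.symm p, true))) = 0 := by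
    simp only [mul_sub, Finset.sum_sub_distrib]
    rw [sub_eq_zero, ← Equiv.sum_comp G.next fun p => b p * f (G.faceRight (G.next.symm p, true))]
    simp [hb]
  simp only [Fintype.sum_prod_type, Fintype.sum_bool, (faceRight_next_sub f _).1,
    (faceRight_next_sub f _).2, hf, ha', ite_self] at h0
  rw [eq_comm, ← sub_eq_zero, ← Finset.sum_sub_distrib, ← h0]
  exact Finset.sum_congr rfl fun c _ => by ring

end GaussCode

/-! ### Cocycles over a cycle of a permutation -/

namespace Equiv.Perm

variable {P : Type*} (f : Perm P)

theorem pow_apply_eq_of_step {X : Type*} (T : Perm X) {e : P → ℤ} {g : P → X}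
    (hg : ∀ p, g (f p) = (T ^ e p) (g p)) (k : ℕ) (p : P) :
    g ((f ^ k) p) = (T ^ ∑ i ∈ Finset.range k, e ((f ^ i) p)) (g p) := by
  induction k with
  | zero => simp
  | succ k ih =>
    rw [pow_succ', Perm.mul_apply, hg, ih, Finset.sum_range_succ, add_comm, zpow_add,
      Perm.mul_apply]

theorem IsCycleOn.sum_range_card {s : Finset P} {f : Perm P} (hf : f.IsCycleOn (s : Set P))
    {a : P} (ha : a ∈ s) (e : P → ℤ) :
    ∑ i ∈ Finset.range s.card, e ((f ^ i) a) = ∑ x ∈ s, e x := by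
  refine Finset.sum_nbij (fun i => (f ^ i) a) (fun i _ => ?_) (fun i hi j hj h => ?_)
    (fun b hb => ?_) fun _ _ => rfl
  · exact (hf.1.perm_pow i).mapsTo ha
  · exact Nat.ModEq.eq_of_lt_of_lt ((hf.pow_apply_eq_pow_apply ha).1 h)
      (Finset.mem_range.1 hi) (Finset.mem_range.1 hj)
  · obtain ⟨n, hn, rfl⟩ := hf.exists_pow_eq ha hb
    exact ⟨n, by simpa using hn, rfl⟩

variable [Fintype P]

open Classical in
theorem isCycleOn_filter_sameCycle (a : P) :
    f.IsCycleOn ((Finset.univ.filter fun q => f.SameCycle a q : Finset P) : Set P) := by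
  refine ⟨⟨fun x hx => ?_, f.injective.injOn, fun x hx => ⟨f.symm x, ?_, by simp⟩⟩,
    fun x hx y hy => ?_⟩
  · simpa using hx
  · have : f.SameCycle a (f (f.symm x)) := by simpa using hx
    simpa using this
  · simp only [Finset.coe_filter, Finset.mem_univ, true_and, Set.mem_ofPred_eq] at hx hy
    exact hx.symm.trans hy

open Classical in
/-- The total of `e` over the cycle of `a`. -/
noncomputable def cycleSum (e : P → ℤ) (a : P) : ℤ :=
  ∑ q ∈ Finset.univ.filter fun q => f.SameCycle a q, e q

/-- One full turn around the cycle composes all the steps and comes back to `a`. -/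
theorem apply_eq_zpow_cycleSum {X : Type*} (T : Perm X) {e : P → ℤ} {g : P → X}
    (hg : ∀ p, g (f p) = (T ^ e p) (g p)) (a : P) :
    (T ^ f.cycleSum e a) (g a) = g a := by
  classical
  have hs := f.isCycleOn_filter_sameCycle a
  have ha : a ∈ Finset.univ.filter fun q => f.SameCycle a q := by
    simp [SameCycle.refl]
  rw [cycleSum, ← hs.sum_range_card ha, ← f.pow_apply_eq_of_step T hg, hs.pow_card_apply ha]

/-- Along the cycle of `a`, the partial sums of `e` are well defined modulo the total. -/
theorem exists_potential (e : P → ℤ) (a : P) :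
    ∃ u : P → ℤ, ∀ k : ℕ, f.cycleSum e a ∣ u ((f ^ k) a) - ∑ i ∈ Finset.range k, e ((f ^ i) a) := by
  classical
  have hs := f.isCycleOn_filter_sameCycle a
  have ha : a ∈ Finset.univ.filter fun q => f.SameCycle a q := by
    simp [SameCycle.refl]
  set s := Finset.univ.filter fun q => f.SameCycle a q
  set S : ℕ → ℤ := fun k => ∑ i ∈ Finset.range k, e ((f ^ i) a) with hS
  have hadd (k : ℕ) : S (s.card + k) = f.cycleSum e a + S k := by
    simp only [hS, Finset.sum_range_add, hs.sum_range_card ha, pow_add, Perm.mul_apply]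
    congr 1
    refine Finset.sum_congr rfl fun i _ => ?_
    rw [← Perm.mul_apply, ← pow_add, add_comm, pow_add, Perm.mul_apply, hs.pow_card_apply ha]
  have hmod (k t : ℕ) : f.cycleSum e a ∣ S (s.card * t + k) - S k := by
    induction t with
    | zero => simp
    | succ t ih =>
      rw [mul_add, mul_one, add_comm _ s.card, add_assoc, hadd, add_sub_assoc]
      exact dvd_add dvd_rfl ih
  have hdiff (k : ℕ) : f.cycleSum e a ∣ S k - S (k % s.card) := by
    have := hmod (k % s.card) (k / s.card)
    rwa [Nat.div_add_mod] at this
  -- Any exponent that reaches `p` will do: two of them differ by whole turns, each adding the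
  -- total. The value off the cycle is irrelevant.
  refine ⟨fun p => if h : ∃ k, (f ^ k) a = p then S h.choose else 0, fun k => ?_⟩
  have hk : ∃ l, (f ^ l) a = (f ^ k) a := ⟨k, rfl⟩
  simp only [hk, dif_pos]
  have h1 : hk.choose % s.card = k % s.card := (hs.pow_apply_eq_pow_apply ha).1 hk.choose_spec
  have h2 := dvd_sub (hdiff hk.choose) (hdiff k)
  rwa [h1, sub_sub_sub_cancel_right] at h2

/-- A value at `a` that is fixed by the total twist spreads over the cycle of `a`. -/
theorem exists_of_zpow_cycleSum {X : Type*} (T : Perm X) (e : P → ℤ) (a : P) {x : X}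
    (hx : (T ^ f.cycleSum e a) x = x) :
    ∃ g : P → X, g a = x ∧ ∀ p, f.SameCycle a p → g (f p) = (T ^ e p) (g p) := by
  obtain ⟨u, hu⟩ := f.exists_potential e a
  have hfix {d : ℤ} (hd : f.cycleSum e a ∣ d) : (T ^ d) x = x := by
    obtain ⟨t, rfl⟩ := hd
    rw [zpow_mul]
    exact Function.IsFixedPt.perm_zpow hx t
  -- The error `u (f p) - u p - e p` is a multiple of the total, so the corresponding power of `T`
  -- fixes `x`.
  refine ⟨fun p => (T ^ u p) x, hfix (by simpa using hu 0), fun p hp => ?_⟩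
  obtain ⟨k, rfl⟩ := hp.exists_nat_pow_eq
  have h := dvd_sub (hu (k + 1)) (hu k)
  rw [Finset.sum_range_succ, pow_succ', Perm.mul_apply] at h
  generalize (f ^ k) a = p at h ⊢
  have h' := hfix (d := u (f p) - u p - e p) (h.trans (dvd_of_eq (by ring)))
  calc (T ^ u (f p)) x = (T ^ (e p + u p)) ((T ^ (u (f p) - u p - e p)) x) := by
        rw [← Perm.mul_apply, ← zpow_add]; congr 2; ring
    _ = _ := by rw [h', zpow_add, Perm.mul_apply]

end Equiv.Perm

/-! ### Linking numbers -/

namespace LinkDiagram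

variable (D : LinkDiagram)

instance : Finite D.Component :=
  inferInstanceAs (Finite (Quotient (Equiv.Perm.SameCycle.setoid D.next) ⊕ Fin D.loops))

theorem componentOf_next (p : D.Pass) : D.componentOf (D.next p) = D.componentOf p :=
  congrArg Sum.inl (Quotient.sound ((Equiv.Perm.SameCycle.refl D.next p).apply_left))

/-- The sum over all crossings of the sign, weighted with a function `F` of the over component and
the under component. -/
def linkSum (F : D.Component → D.Component → ℤ) : ℤ :=
  ∑ c, (D.sign c : ℤ) * F (D.componentOf (c, true)) (D.componentOf (c, false))

open Classical in
/-- The sum of the signs of the crossings where `i` passes over `j`. -/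
noncomputable def overSum (i j : D.Component) : ℤ :=
  D.linkSum fun i' j' => if i' = i ∧ j' = j then 1 else 0

/-- The indicator functions of two components are cycles, and their intersection number is the
difference of the two sides up to sign. -/
theorem overSum_comm (i j : D.Component) : D.overSum i j = D.overSum j i := by
  classical
  have h := D.planar.sum_intersections_eq_zero
    (a := fun p => if D.componentOf p = i then 1 else 0)
    (b := fun p => if D.componentOf p = j then 1 else 0)
    (fun p => by rw [componentOf_next]) (fun p => by rw [componentOf_next])
  have key (k l) : ((D.overSum k l : ℤ) : ℚ) = ∑ c, ((D.sign c : ℤ) : ℚ) *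
      ((if D.componentOf (c, true) = k then 1 else 0) *
        if D.componentOf (c, false) = l then 1 else 0) := by
    simp [overSum, linkSum, ← ite_and, and_comm]
  exact_mod_cast (key i j).trans (h.trans (key j i).symm)

theorem linkingNumber_eq_overSum {i j : D.Component} (hij : i ≠ j) :
    D.linkingNumber i j = D.overSum i j := by
  classical
  have h : D.linkingNumber i j = ((D.overSum i j : ℤ) + (D.overSum j i : ℤ) : ℚ) / 2 := by
    rw [linkingNumber, overSum, overSum, linkSum, linkSum]
    push_cast
    rw [← Finset.sum_add_distrib]
    congr 1
    refine Finset.sum_congr rfl fun c _ => ?_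
    by_cases h1 : D.componentOf (c, true) = i ∧ D.componentOf (c, false) = j
    · have h2 : ¬(D.componentOf (c, true) = j ∧ D.componentOf (c, false) = i) :=
        fun h2 => hij (h1.1.symm.trans h2.1)
      simp [h1, hij]
    · by_cases h2 : D.componentOf (c, true) = j ∧ D.componentOf (c, false) = i
      · simp [h2, hij.symm]
      · simp [h1, h2]
  rw [h, D.overSum_comm j i]
  ring

theorem linkSum_eq [Fintype D.Component] (F : D.Component → D.Component → ℤ) :
    D.linkSum F = ∑ i, ∑ j, F i j * D.overSum i j := by
  classical
  have h (c : D.Crossing) : (D.sign c : ℤ) * F (D.componentOf (c, true)) (D.componentOf (c, false))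
      = ∑ i, ∑ j, F i j * ((D.sign c : ℤ) *
        if D.componentOf (c, true) = i ∧ D.componentOf (c, false) = j then 1 else 0) := by
    simp [ite_and, mul_comm]
  simp only [linkSum, overSum, h, Finset.mul_sum]
  rw [Finset.sum_comm]
  exact Finset.sum_congr rfl fun i _ => Finset.sum_comm

variable {D} {D' : LinkDiagram}

/-- A signed count of crossings between distinct components depends only on the linking graph. -/
theorem linkSum_eq_of_linkingNumber_eq {e : D.Component ≃ D'.Component}
    (he : ∀ i j, i ≠ j → D'.linkingNumber (e i) (e j) = D.linkingNumber i j)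
    {F : D.Component → D.Component → ℤ} {F' : D'.Component → D'.Component → ℤ}
    (hF : ∀ i, F i i = 0) (hFF' : ∀ i j, F' (e i) (e j) = F i j) :
    D'.linkSum F' = D.linkSum F := by
  have : Fintype D.Component := Fintype.ofFinite _
  have : Fintype D'.Component := Fintype.ofFinite _
  rw [linkSum_eq, linkSum_eq, ← Equiv.sum_comp e]
  refine Finset.sum_congr rfl fun i _ => ?_
  rw [← Equiv.sum_comp e]
  refine Finset.sum_congr rfl fun j _ => ?_
  rw [hFF']
  rcases eq_or_ne i j with rfl | hij
  · simp [hF]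
  · have h := he i j hij
    rw [linkingNumber_eq_overSum _ hij, linkingNumber_eq_overSum _ (e.injective.ne hij)] at h
    rw [Int.cast_injective (α := ℚ) h]

end LinkDiagram

/-! ### Colorings by the quandles with one non-trivial column -/

namespace PQuandle

variable {n : ℕ} (σ : Equiv.Perm (Fin n))

/-- The element `0`. -/
def zero : PQuandle σ := (none : Option (Fin n))

/-- The non-trivial column `x ↦ x * 0`. -/
def shift : Equiv.Perm (PQuandle σ) := Equiv.optionCongr σ

theorem shift_zero : shift σ (zero σ) = zero σ := rfl

theorem shift_zpow_zero (k : ℤ) : (shift σ ^ k) (zero σ) = zero σ :=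
  Function.IsFixedPt.perm_zpow (shift_zero σ) k

theorem shift_zpow_eq_zero_iff {k : ℤ} {x : PQuandle σ} :
    (shift σ ^ k) x = zero σ ↔ x = zero σ := by
  rw [← (shift σ ^ k).injective.eq_iff (a := x), shift_zpow_zero]

open Classical in
-- With every column a power of one permutation, the exponents simply add up along a component.
theorem act_eq (y x : PQuandle σ) :
    y ◃ x = (shift σ ^ if y = zero σ then (1 : ℤ) else 0) x := by
  by_cases h : y = zero σ
  · rw [if_pos h, zpow_one, h]
    rcases x with _ | x <;> rfl
  · rw [if_neg h]
    rcases y with _ | y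
    · exact absurd rfl h
    · rfl

open Classical in
theorem theta_apply (x y : PQuandle σ) : (theta σ).toFun x y =
    Multiplicative.ofAdd (if x = zero σ ∧ y ≠ zero σ then (1 : ℤ) else 0) := by
  rcases x with _ | x
  · rcases y with _ | y
    · rw [if_neg fun h => h.2 rfl]; rfl
    · rw [if_pos ⟨rfl, Option.some_ne_none y⟩]; rfl
  · rw [if_neg fun h => Option.some_ne_none x h.1]; rfl

end PQuandle

/-! ### Twists along components and admissible base colors -/

namespace LinkDiagram

theorem sameCycle_out (D : LinkDiagram) (p : D.Pass) :
    D.next.SameCycle (Quotient.mk (Equiv.Perm.SameCycle.setoid D.next) p).out p :=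
  Quotient.exact (s := Equiv.Perm.SameCycle.setoid D.next) (Quotient.out_eq _)

variable {D : LinkDiagram} {n : ℕ} {σ : Equiv.Perm (Fin n)}

open Classical in
/-- If the components in `Z` have color `0`, then the color of the strand that arrives at a pass is
changed by this power of the shift. -/
noncomputable def twist (D : LinkDiagram) (Z : D.Component → Prop) : D.Pass → ℤ
  | (_, true) => 0
  | (c, false) => if Z (D.componentOf (c, true)) then (D.sign c : ℤ) else 0

open Classical in
/-- The total twist along the component `i`. -/
noncomputable def totalTwist (D : LinkDiagram) (Z : D.Component → Prop) (i : D.Component) : ℤ :=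
  D.linkSum fun j i' => if Z j ∧ i' = i then 1 else 0

/-- The step from `q` to `next q` is governed by the pass reached, hence the shift by `next`; it
only permutes the summands of a cycle. -/
theorem cycleSum_twist (Z : D.Component → Prop) (p : D.Pass) :
    D.next.cycleSum (fun q => D.twist Z (D.next q)) p = D.totalTwist Z (D.componentOf p) := by
  classical
  have h (q : D.Pass) : D.next.SameCycle p q ↔ D.componentOf (D.next q) = D.componentOf p := by
    rw [componentOf_next]
    exact Equiv.Perm.sameCycle_comm.trans
      ((Quotient.eq (r := Equiv.Perm.SameCycle.setoid D.next)).symm.trans Sum.inl_injective.eq_iff.symm)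
  simp only [Equiv.Perm.cycleSum, Finset.sum_filter, h]
  rw [Equiv.sum_comp D.next fun q => if D.componentOf q = D.componentOf p then D.twist Z q else 0]
  simp only [Fintype.sum_prod_type, Fintype.sum_bool, twist, totalTwist, linkSum, ite_self, zero_add]
  refine Finset.sum_congr rfl fun c _ => ?_
  by_cases h1 : D.componentOf (c, false) = D.componentOf p <;> simp [h1]

theorem totalTwist_inr (Z : D.Component → Prop) (l : Fin D.loops) :
    D.totalTwist Z (Sum.inr l) = 0 := by
  simp [totalTwist, linkSum, componentOf]

/-- The colors of the components at base points that extend to a coloring. -/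
def IsAdmissible (κ : D.Component → PQuandle σ) : Prop :=
  ∀ i, (PQuandle.shift σ ^ D.totalTwist (fun j => κ j = PQuandle.zero σ) i) (κ i) = κ i

/-- Admissibility depends only on the linking graph. -/
theorem isAdmissible_comp_symm_iff {D' : LinkDiagram} {e : D.Component ≃ D'.Component}
    (he : ∀ i j, i ≠ j → D'.linkingNumber (e i) (e j) = D.linkingNumber i j)
    (κ : D.Component → PQuandle σ) : IsAdmissible (κ ∘ e.symm) ↔ IsAdmissible κ := by
  classical
  refine (e.forall_congr_right (q := fun i => (PQuandle.shift σ ^ D'.totalTwist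
    (fun j => (κ ∘ e.symm) j = PQuandle.zero σ) i) ((κ ∘ e.symm) i) = (κ ∘ e.symm) i)).symm.trans
    (forall_congr' fun i => ?_)
  simp only [Function.comp_apply, Equiv.symm_apply_apply]
  -- If `i` has color 0, its twist may involve self-crossings, but every power of the shift fixes 0.
  -- Otherwise only other components twist it.
  by_cases hi : κ i = PQuandle.zero σ
  · simp [hi, PQuandle.shift_zpow_zero]
  · have h : D'.totalTwist (fun j => κ (e.symm j) = PQuandle.zero σ) (e i) =
        D.totalTwist (fun j => κ j = PQuandle.zero σ) i := by
      refine linkSum_eq_of_linkingNumber_eq he (fun j => if_neg ?_) fun j k => ?_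
      · rintro ⟨h, rfl⟩
        exact hi h
      · exact ite_congr (by simp) (fun _ => rfl) fun _ => rfl
    rw [h]

end LinkDiagram

/-! ### Colorings as admissible base colors -/

namespace Coloring

open LinkDiagram

variable {D : LinkDiagram}

/-- The colors of the components at base points. -/
noncomputable def baseColor {X : Type*} [Quandle X] (C : Coloring X D) : D.Component → X :=
  Sum.elim (fun q => C.edge q.out) C.loop

theorem baseColor_map {X : Type*} [Quandle X] (f : X →◃ X) (C : Coloring X D) (i : D.Component) :
    (C.map f).baseColor i = f.toFun (C.baseColor i) := by
  rcases i with q | l <;> rfl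

variable {n : ℕ} {σ : Equiv.Perm (Fin n)}

theorem edge_next_eq_zero_iff (C : Coloring (PQuandle σ) D) (p : D.Pass) :
    C.edge (D.next p) = PQuandle.zero σ ↔ C.edge p = PQuandle.zero σ := by
  obtain ⟨q, rfl⟩ := D.next.symm.surjective p
  rw [Equiv.apply_symm_apply]
  obtain ⟨c, _ | _⟩ := q
  · rcases Int.units_eq_one_or (D.sign c) with h | h
    · rw [C.under_pos c h, PQuandle.act_eq, PQuandle.shift_zpow_eq_zero_iff]
    · rw [C.under_neg c h, PQuandle.act_eq, PQuandle.shift_zpow_eq_zero_iff]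
  · rw [C.over_pass]

theorem edge_eq_zero_iff (C : Coloring (PQuandle σ) D) (p : D.Pass) :
    C.edge p = PQuandle.zero σ ↔ C.baseColor (D.componentOf p) = PQuandle.zero σ := by
  change _ ↔ C.edge (Quotient.out _) = _
  obtain ⟨k, hk⟩ := (D.sameCycle_out p).exists_nat_pow_eq
  generalize Quotient.out _ = a at hk ⊢
  subst hk
  induction k with
  | zero => rfl
  | succ k ih => rwa [pow_succ', Equiv.Perm.mul_apply, edge_next_eq_zero_iff]

open Classical in
theorem edge_next (C : Coloring (PQuandle σ) D) (p : D.Pass) :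
    C.edge (D.next p) =
      (PQuandle.shift σ ^ D.twist (fun i => C.baseColor i = PQuandle.zero σ) (D.next p))
        (C.edge p) := by
  obtain ⟨q, rfl⟩ := D.next.symm.surjective p
  rw [Equiv.apply_symm_apply]
  obtain ⟨c, _ | _⟩ := q
  · simp only [twist, ← edge_eq_zero_iff]
    rcases Int.units_eq_one_or (D.sign c) with h | h
    · rw [C.under_pos c h, PQuandle.act_eq, h]
      rfl
    · rw [C.under_neg c h, PQuandle.act_eq, h, ← Equiv.Perm.mul_apply, ← zpow_add]
      split_ifs <;> rfl
  · rw [C.over_pass]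
    rfl

theorem isAdmissible_baseColor (C : Coloring (PQuandle σ) D) : IsAdmissible C.baseColor := by
  rintro (q | l)
  · have h := D.next.apply_eq_zpow_cycleSum _ C.edge_next q.out
    rw [cycleSum_twist] at h
    have hq : D.componentOf q.out = Sum.inl q := congrArg Sum.inl q.out_eq
    rwa [hq] at h
  · rw [totalTwist_inr]
    rfl

/-- The base colors determine which components are 0, hence all twists, hence every color from the
base point on. -/
theorem baseColor_injective :
    Function.Injective (baseColor : Coloring (PQuandle σ) D → D.Component → PQuandle σ) := by
  intro C C' h
  refine Coloring.ext (funext fun p => ?_) (funext fun l => congrFun h (Sum.inr l))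
  obtain ⟨k, hk⟩ := (D.sameCycle_out p).exists_nat_pow_eq
  have h0 : C.edge (Quotient.out _) = C'.edge (Quotient.out _) := congrFun h (D.componentOf p)
  rw [← hk, D.next.pow_apply_eq_of_step _ C.edge_next, D.next.pow_apply_eq_of_step _ C'.edge_next,
    h, h0]

theorem exists_baseColor_eq {κ : D.Component → PQuandle σ} (hκ : IsAdmissible κ) :
    ∃ C : Coloring (PQuandle σ) D, C.baseColor = κ := by
  classical
  have hex (q : Quotient (Equiv.Perm.SameCycle.setoid D.next)) := by
    have hq : D.componentOf q.out = Sum.inl q := congrArg Sum.inl q.out_eq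
    have h := hκ (Sum.inl q)
    rw [← hq, ← cycleSum_twist] at h
    exact D.next.exists_of_zpow_cycleSum _ _ _ h
  choose g hg0 hg using hex
  have hg0 (q) : g q q.out = κ (Sum.inl q) :=
    (hg0 q).trans (congrArg κ (congrArg Sum.inl q.out_eq))
  let E (p : D.Pass) : PQuandle σ := g (Quotient.mk _ p) p
  have hE (p : D.Pass) : E (D.next p) =
      (PQuandle.shift σ ^ D.twist (fun i => κ i = PQuandle.zero σ) (D.next p)) (E p) := by
    have h := hg (Quotient.mk _ p) p (D.sameCycle_out p)
    rw [← h]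
    exact congrFun (congrArg g (Sum.inl_injective (D.componentOf_next p))) _
  -- The twists were prescribed by `κ`; they obey the coloring rule because the over strands colored
  -- 0 by `E` are exactly those that `κ` makes 0.
  have hzero (p : D.Pass) : E p = PQuandle.zero σ ↔ κ (D.componentOf p) = PQuandle.zero σ := by
    obtain ⟨k, hk⟩ := (D.sameCycle_out p).exists_nat_pow_eq
    rw [componentOf, ← hg0]
    conv_lhs => rw [← hk, D.next.pow_apply_eq_of_step _ hE, PQuandle.shift_zpow_eq_zero_iff]
    simp only [E, Quotient.out_eq]
  have hE' (q : D.Pass) : E q =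
      (PQuandle.shift σ ^ D.twist (fun i => κ i = PQuandle.zero σ) q) (E (D.next.symm q)) := by
    simpa using hE (D.next.symm q)
  refine ⟨⟨E, fun l => κ (Sum.inr l), fun c => ?_, fun c h => ?_, fun c h => ?_⟩, ?_⟩
  · rw [hE' (c, true)]
    rfl
  · rw [hE' (c, false), PQuandle.act_eq]
    simp only [twist, hzero, h]
    rfl
  · rw [PQuandle.act_eq, hE' (c, false), ← Equiv.Perm.mul_apply, ← zpow_add]
    simp only [twist, hzero, h]
    split_ifs <;> rfl
  · funext i
    rcases i with q | l
    · change E q.out = _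
      rw [← hg0]
      simp only [E, Quotient.out_eq]
    · rfl

/-- Diagrams with the same linking graph have the same colorings, described by the colors of the
components at base points. -/
theorem exists_equiv_baseColor {D' : LinkDiagram} {e : D.Component ≃ D'.Component}
    (he : ∀ i j, i ≠ j → D'.linkingNumber (e i) (e j) = D.linkingNumber i j) :
    ∃ Φ : Coloring (PQuandle σ) D ≃ Coloring (PQuandle σ) D',
      ∀ C, (Φ C).baseColor = C.baseColor ∘ e.symm := by
  have h (C : Coloring (PQuandle σ) D) :
      ∃ C' : Coloring (PQuandle σ) D', C'.baseColor = C.baseColor ∘ e.symm :=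
    exists_baseColor_eq ((isAdmissible_comp_symm_iff he _).2 C.isAdmissible_baseColor)
  choose Φ hΦ using h
  refine ⟨Equiv.ofBijective Φ ⟨fun C C' h => baseColor_injective ?_, fun C' => ?_⟩, hΦ⟩
  · have := (hΦ C).symm.trans ((congrArg baseColor h).trans (hΦ C'))
    exact e.symm.surjective.injective_comp_right this
  · have hadm : IsAdmissible (C'.baseColor ∘ e) := by
      rw [← isAdmissible_comp_symm_iff he, Function.comp_assoc, e.self_comp_symm]
      exact C'.isAdmissible_baseColor
    obtain ⟨C, hC⟩ := exists_baseColor_eq hadm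
    refine ⟨C, baseColor_injective ?_⟩
    rw [hΦ, hC, Function.comp_assoc, e.self_comp_symm, Function.comp_id]

open Classical in
-- Whether the under color is 0 does not depend on the side of the over strand, so each factor
-- depends only on the sign and the two components.
theorem weight_theta (C : Coloring (PQuandle σ) D) :
    C.weight (PQuandle.theta σ) = Multiplicative.ofAdd (D.linkSum fun i j =>
      if C.baseColor j = PQuandle.zero σ ∧ C.baseColor i ≠ PQuandle.zero σ then 1 else 0) := by
  have hu (c : D.Crossing) : C.underColor c = PQuandle.zero σ ↔
      C.baseColor (D.componentOf (c, false)) = PQuandle.zero σ := by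
    rw [underColor, ← edge_eq_zero_iff]
    split_ifs
    · rw [← edge_next_eq_zero_iff, Equiv.apply_symm_apply]
    · rfl
  simp only [weight, linkSum, ofAdd_sum, PQuandle.theta_apply, hu, overColor, ne_eq,
    edge_eq_zero_iff, ← ofAdd_zsmul, smul_eq_mul]

end Coloring

open Coloring in
theorem mainTheorem4 (D D' : LinkDiagram) (h : D.LinkingGraphsIsomorphic D') :
    (∀ (n : ℕ) (σ : Equiv.Perm (Fin n)) (S : Set (PQuandle σ →◃ PQuandle σ)),
      Nonempty (QuiverIso (QuandleQuiver S D) (QuandleQuiver S D'))) ∧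
    (∀ (n : ℕ) (σ : Equiv.Perm (Fin n)), σ.IsCycleOn Set.univ →
      cocycleInvariant (PQuandle.theta σ) D = cocycleInvariant (PQuandle.theta σ) D') := by
  classical
  obtain ⟨e, he⟩ := h
  refine ⟨fun n σ S => ?_, fun n σ _ => ?_⟩ <;>
    obtain ⟨Φ, hΦ⟩ := exists_equiv_baseColor (σ := σ) he
  · have hmap (f : PQuandle σ →◃ PQuandle σ) (C) : map f (Φ C) = Φ (map f C) := by
      refine baseColor_injective (funext fun i => ?_)
      rw [baseColor_map, hΦ, hΦ, Function.comp_apply, Function.comp_apply, baseColor_map]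
    exact ⟨⟨Φ, fun C C' => Equiv.subtypeEquivRight fun f => and_congr_right fun _ =>
      Φ.injective.eq_iff.symm.trans (iff_of_eq (congrArg (· = Φ C') (hmap f C).symm))⟩⟩
  · let _ := Fintype.ofFinite (Coloring (PQuandle σ) D)
    let _ := Fintype.ofFinite (Coloring (PQuandle σ) D')
    refine Fintype.sum_equiv Φ _ _ fun C => ?_
    rw [weight_theta, weight_theta]
    congr 2
    -- No component is both zero and nonzero, so the diagonal terms vanish.
    refine (LinkDiagram.linkSum_eq_of_linkingNumber_eq he (fun i => if_neg fun h => h.2 h.1)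
      fun i j => ?_).symm
    simp [hΦ]
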